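/- Let $n>m>1$ be integers and let $\mathcal N=\{L_1,\dots,L_n\}$ be a normal system in $\mathbb R^m$: $n$ distinct lines through the origin such that, for nonzero $v_i=(a_{i1},\dots,a_{im})\in L_i$, any at most $m$ of the vectors $v_1,\dots,v_n$ are linearly independent. Fix such a matrix $[a_{ij}]$. Let $\mathcal E$ be the set of all $(m+1)$-element subsets of $\{1,\dots,n\}$. For $S=\{i_1<\dots<i_{m+1}\}\in\mathcal E$ let $M_S\subset\mathbb R^n$ be the hyperplane of all $(y_1,\dots,y_n)$ for which the $(m+1)\times(m+1)$ matrix with rows $(a_{i_k1},\dots,a_{i_km},y_{i_k})$, $1\le k\le m+1$, has determinant $0$, and let $\mathcal C=\{M_S : S\in\mathcal E\}$ be the discriminantal arrangement. Let $r(\mathcal C)$ be the number of connected components of $\mathbb R^n\setminus\bigcup_S M_S$, and let $\chi(\mathcal C)(x)=\sum_X\mu(\mathbb R^n,X)\,x^{\dim X}$ be the characteristic polynomial, where $X$ runs over all intersections of members of $\mathcal C$ (including $\mathbb R^n$), ordered by reverse inclusion, and $\mu$ is the Möbius function. For $\mathcal D\subseteq\mathcal E$ put $d_{\mathcal D}=\dim\bigcap_{S\in\mathcal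 D}M_S$. Combinatorial notions. For $\mathcal D\subseteq\mathcal E$ and $S\in\mathcal E$ say that $\mathcal D$ forces $S$ if there are distinct $S_1,\dots,S_r\in\mathcal D$, all different from $S$, with $|\bigcup_{j\in J}S_j|\ge m+|J|$ for every nonempty $J\subseteq\{1,\dots,r\}$ and $|S\cup\bigcup_{j=1}^rS_j|<m+r+1$. The collection $\mathcal D$ is concurrency closed if it contains every $S$ that it forces; the concurrency closure $\overline{\mathcal D}$ is obtained from $\mathcal D$ by repeatedly adding all forced sets. A base collection for $\mathcal D$ is an inclusion-minimal collection among those whose closure is $\overline{\mathcal D}$, and $\operatorname{rank}(\overline{\mathcal D})$ is the cardinality of a base collection for $\overline{\mathcal D}$. The normal system is concurrency free if for every concurrency closed $\mathcal D\subseteq\mathcal E$ and every base collection $\mathcal D'$ for $\mathcal D$ one has $\#\mathcal D'=n-d_{\mathcal D}=n-d_{\mathcal D'}$. Isomorphism classes. Consider the arrangements $H=(H_1,\dots,H_n)$ with $H_i=\{x\in\mathbb R^m:\sum_j a_{ij}x_j=b_i\}$, $b\in\mathbb R^n$, that are generic: any $r$ of the $H_i$ meet in a flat of dimension $m-r$ if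 $1\le r\le m$, and have empty intersection if $r>m$. Two of them, $H$ and $H'$, are isomorphic by an isomorphism preserving subscripts if, for every set $A$ of $m-1$ subscripts, the lines $\bigcap_{i\in A}H_i$ and $\bigcap_{i\in A}H_i'$ can be oriented so that the vertices $H_j\cap\bigcap_{i\in A}H_i$ and $H'_j\cap\bigcap_{i\in A}H'_i$, $j\notin A$, occur on them in the same order of the subscripts $j$. This is an equivalence relation. Theorem. Suppose that the normal system is concurrency free. Then the number of isomorphism classes under subscript-preserving isomorphisms is finite and equals $$\tfrac12\,r(\mathcal C)=\tfrac{(-1)^n}{2}\,\chi(\mathcal C)(-1)=\tfrac12\sum_{\mathcal D\subseteq\mathcal E}(-1)^{n+\#\mathcal D+d_{\mathcal D}}=\tfrac12\sum_{\mathcal D\subseteq\mathcal E}(-1)^{\#\mathcal D+\operatorname{rank}(\overline{\mathcal D})},$$ where, for every $\mathcal D\subseteq\mathcal E$, all base collections for $\overline{\mathcal D}$ have the same cardinality $\operatorname{rank}(\overline{\mathcal D})=n-d_{\mathcal D}$. The last sum depends only on $n$ and $m$. -/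

import Mathlib

namespace Discriminantal

open Module

/-! ### Affine hyperplanes, generic arrangements and their isomorphisms -/

/-- The affine subspace `{x | ∑ j, v j * x j = c}` of `ℝ^m`. -/
def hyperplane {m : ℕ} (v : Fin m → ℝ) (c : ℝ) : AffineSubspace ℝ (Fin m → ℝ) where
  carrier := {x | ∑ j, v j * x j = c}
  smul_vsub_vadd_mem' := by
    intro t p q r hp hq hr
    simp only [Set.mem_ofPred_eq] at *
    have : ∑ j, v j * (t • (p -ᵥ q) +ᵥ r) j
        = t * (∑ j, v j * p j - ∑ j, v j * q j) + ∑ j, v j * r j := by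
      rw [← Finset.sum_sub_distrib, Finset.mul_sum, ← Finset.sum_add_distrib]
      refine Finset.sum_congr rfl fun j _ => ?_
      simp only [vsub_eq_sub, vadd_eq_add, Pi.add_apply, Pi.smul_apply, Pi.sub_apply, smul_eq_mul]
      ring
    rw [this, hp, hq, hr]
    ring

/-- The intersection of the members of `H` with subscript in `s`. -/
def flat {n m : ℕ} (H : Fin n → AffineSubspace ℝ (Fin m → ℝ)) (s : Finset (Fin n)) :
    AffineSubspace ℝ (Fin m → ℝ) :=
  ⨅ i ∈ s, H i

/-- General position: for `1 ≤ r ≤ m` any `r` members of `H` meet in a (nonempty) flat of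
dimension `m - r`, and for `r > m` any `r` members have empty intersection. -/
structure IsGeneric {n m : ℕ} (H : Fin n → AffineSubspace ℝ (Fin m → ℝ)) : Prop where
  nonempty_of_le : ∀ s : Finset (Fin n), 1 ≤ s.card → s.card ≤ m →
    (flat H s : Set (Fin m → ℝ)).Nonempty
  finrank_of_le : ∀ s : Finset (Fin n), 1 ≤ s.card → s.card ≤ m →
    finrank ℝ (flat H s).direction = m - s.card
  eq_bot_of_lt : ∀ s : Finset (Fin n), m < s.card → flat H s = ⊥

/-- On a line oriented by the vector `u`, the point `p` comes strictly before the point `q`. -/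
def Precedes {m : ℕ} (u p q : Fin m → ℝ) : Prop :=
  ∃ t : ℝ, 0 < t ∧ q = p + t • u

/-- `φ` is an isomorphism of the (generic) arrangements `H` and `H'`: for every set `s` of `m - 1`
subscripts, the lines `flat H s` and `flat H' (φ s)` can be oriented (by nonzero direction vectors
`u` and `u'`) in such a way that the orders of the vertices on the two lines agree via `φ`.
The vertices on `flat H s` are the points of `flat H (insert j s)` with `j ∉ s`. -/
def IsArrangementIso {n m : ℕ} (φ : Equiv.Perm (Fin n))
    (H H' : Fin n → AffineSubspace ℝ (Fin m → ℝ)) : Prop :=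
  ∀ s : Finset (Fin n), s.card + 1 = m →
    ∃ u ∈ (flat H s).direction, u ≠ 0 ∧
    ∃ u' ∈ (flat H' (s.map φ.toEmbedding)).direction, u' ≠ 0 ∧
      ∀ j ∉ s, ∀ k ∉ s,
        ∀ p ∈ flat H (insert j s), ∀ q ∈ flat H (insert k s),
        ∀ p' ∈ flat H' ((insert j s).map φ.toEmbedding),
        ∀ q' ∈ flat H' ((insert k s).map φ.toEmbedding),
          (Precedes u p q ↔ Precedes u' p' q')

/-- There is a subscript-preserving isomorphism from `H` to `H'`. -/
def SubscriptIso {n m : ℕ} (H H' : Fin n → AffineSubspace ℝ (Fin m → ℝ)) : Prop :=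
  IsArrangementIso (Equiv.refl (Fin n)) H H'

/-! ### Normal systems -/

/-- `n` distinct lines through the origin of `ℝ^m`, such that for nonzero vectors `v i ∈ L i` any
at most `m` of the `v i` are linearly independent. -/
structure IsNormalSystem {n m : ℕ} (L : Fin n → Submodule ℝ (Fin m → ℝ)) : Prop where
  finrank_eq_one : ∀ i, finrank ℝ (L i) = 1
  injective : Function.Injective L
  linearIndependent : ∀ v : Fin n → Fin m → ℝ, (∀ i, v i ∈ L i ∧ v i ≠ 0) →
    ∀ s : Finset (Fin n), s.card ≤ m → LinearIndependent ℝ (fun i : s => v i)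

/-- The rows of `a` are nonzero vectors on the lines `L i`. -/
def IsCoeffMatrix {n m : ℕ} (a : Matrix (Fin n) (Fin m) ℝ)
    (L : Fin n → Submodule ℝ (Fin m → ℝ)) : Prop :=
  ∀ i, a i ∈ L i ∧ a i ≠ 0

/-- The generic arrangements `H i = {x | ∑ j, a i j * x j = b i}` with coefficient matrix `a`. -/
def GenericArrangement {n m : ℕ} (a : Matrix (Fin n) (Fin m) ℝ) : Type :=
  {H : Fin n → AffineSubspace ℝ (Fin m → ℝ) //
    (∃ b : Fin n → ℝ, ∀ i, H i = hyperplane (a i) (b i)) ∧ IsGeneric H}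

theorem finrank_direction_line {n m : ℕ} {H : Fin n → AffineSubspace ℝ (Fin m → ℝ)}
    (hH : IsGeneric H) (s : Finset (Fin n)) (hs : s.card + 1 = m) :
    finrank ℝ (flat H s).direction = 1 := by
  rcases Nat.eq_zero_or_pos s.card with h | h
  · have h0 : s = ∅ := Finset.card_eq_zero.mp h
    subst h0
    have : flat H ∅ = ⊤ := by simp [flat]
    rw [this, AffineSubspace.direction_top, finrank_top]
    simpa using hs.symm
  · rw [hH.finrank_of_le s h (by omega)]
    omega

theorem vertex_unique {n m : ℕ} {H : Fin n → AffineSubspace ℝ (Fin m → ℝ)}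
    (hH : IsGeneric H) (s : Finset (Fin n)) (hs : s.card + 1 = m) (j : Fin n) (hj : j ∉ s)
    {p q : Fin m → ℝ} (hp : p ∈ flat H (insert j s)) (hq : q ∈ flat H (insert j s)) : p = q := by
  have hc : (insert j s).card = m := by rw [Finset.card_insert_of_notMem hj, hs]
  have h0 := hH.finrank_of_le (insert j s) (by omega) (by omega)
  rw [hc, Nat.sub_self, Submodule.finrank_eq_zero] at h0
  have := AffineSubspace.vsub_mem_direction hp hq
  rw [h0, Submodule.mem_bot] at this
  exact vsub_eq_zero_iff_eq.mp this

theorem vertex_exists {n m : ℕ} {H : Fin n → AffineSubspace ℝ (Fin m → ℝ)}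
    (hH : IsGeneric H) (s : Finset (Fin n)) (hs : s.card + 1 = m) (j : Fin n) (hj : j ∉ s) :
    ∃ p, p ∈ flat H (insert j s) := by
  have hc : (insert j s).card = m := by rw [Finset.card_insert_of_notMem hj, hs]
  exact hH.nonempty_of_le (insert j s) (by omega) (by omega)

theorem precedes_neg {m : ℕ} {u p q : Fin m → ℝ} : Precedes (-u) p q ↔ Precedes u q p := by
  constructor
  · rintro ⟨t, ht, rfl⟩
    exact ⟨t, ht, by simp⟩
  · rintro ⟨t, ht, rfl⟩
    exact ⟨t, ht, by simp⟩

theorem precedes_smul {m : ℕ} {u p q : Fin m → ℝ} {c : ℝ} (hc : 0 < c) :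
    Precedes (c • u) p q ↔ Precedes u p q := by
  constructor
  · rintro ⟨t, ht, rfl⟩
    exact ⟨t * c, by positivity, by rw [smul_smul]⟩
  · rintro ⟨t, ht, rfl⟩
    exact ⟨t / c, by positivity, by rw [smul_smul, div_mul_cancel₀ _ hc.ne']⟩

theorem subscriptIso_iff {n m : ℕ} {H H' : Fin n → AffineSubspace ℝ (Fin m → ℝ)} :
    SubscriptIso H H' ↔ ∀ s : Finset (Fin n), s.card + 1 = m →
      ∃ u ∈ (flat H s).direction, u ≠ 0 ∧ ∃ u' ∈ (flat H' s).direction, u' ≠ 0 ∧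
        ∀ j ∉ s, ∀ k ∉ s,
          ∀ p ∈ flat H (insert j s), ∀ q ∈ flat H (insert k s),
          ∀ p' ∈ flat H' (insert j s), ∀ q' ∈ flat H' (insert k s),
            (Precedes u p q ↔ Precedes u' p' q') := by
  have h : ∀ t : Finset (Fin n), t.map (Equiv.refl (Fin n)).toEmbedding = t := fun t => by
    ext x; simp
  simp only [SubscriptIso, IsArrangementIso, h]

theorem subscriptIso_refl {n m : ℕ} {H : Fin n → AffineSubspace ℝ (Fin m → ℝ)}
    (hH : IsGeneric H) : SubscriptIso H H := by
  rw [subscriptIso_iff]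
  intro s hs
  obtain ⟨u, hu, -⟩ := finrank_eq_one_iff'.mp (finrank_direction_line hH s hs)
  have hu' : (u : Fin m → ℝ) ≠ 0 := fun h => hu (Subtype.ext h)
  refine ⟨u, u.2, hu', u, u.2, hu', ?_⟩
  intro j hj k hk p hp q hq p' hp' q' hq'
  rw [vertex_unique hH s hs j hj hp hp', vertex_unique hH s hs k hk hq hq']

theorem subscriptIso_symm {n m : ℕ} {H H' : Fin n → AffineSubspace ℝ (Fin m → ℝ)}
    (h : SubscriptIso H H') : SubscriptIso H' H := by
  rw [subscriptIso_iff] at h ⊢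
  intro s hs
  obtain ⟨u, hu, hu0, u', hu', hu0', hh⟩ := h s hs
  exact ⟨u', hu', hu0', u, hu, hu0, fun j hj k hk p hp q hq p' hp' q' hq' =>
    (hh j hj k hk p' hp' q' hq' p hp q hq).symm⟩

theorem subscriptIso_trans {n m : ℕ} {H H' H'' : Fin n → AffineSubspace ℝ (Fin m → ℝ)}
    (hG : IsGeneric H') (h : SubscriptIso H H') (h' : SubscriptIso H' H'') :
    SubscriptIso H H'' := by
  rw [subscriptIso_iff] at h h' ⊢
  intro s hs
  obtain ⟨u, hu, hu0, v, hv, hv0, hh⟩ := h s hs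
  obtain ⟨w, hw, hw0, z, hz, hz0, hh'⟩ := h' s hs
  obtain ⟨c, hc⟩ := (finrank_eq_one_iff_of_nonzero' (⟨w, hw⟩ : (flat H' s).direction)
    (fun e => hw0 (congrArg Subtype.val e))).mp (finrank_direction_line hG s hs) ⟨v, hv⟩
  have hvw : v = c • w := (congrArg Subtype.val hc).symm
  have hc0 : c ≠ 0 := by
    rintro rfl
    exact hv0 (by simpa using hvw)
  rcases lt_or_gt_of_ne hc0 with hneg | hpos
  · refine ⟨u, hu, hu0, -z, Submodule.neg_mem _ hz, neg_ne_zero.mpr hz0, ?_⟩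
    intro j hj k hk p hp q hq p'' hp'' q'' hq''
    obtain ⟨p', hp'⟩ := vertex_exists hG s hs j hj
    obtain ⟨q', hq'⟩ := vertex_exists hG s hs k hk
    rw [hh j hj k hk p hp q hq p' hp' q' hq', precedes_neg,
      ← hh' k hk j hj q' hq' p' hp' q'' hq'' p'' hp'', ← precedes_neg (u := w),
      ← precedes_smul (u := -w) (c := -c) (by linarith), hvw]
    simp
  · refine ⟨u, hu, hu0, z, hz, hz0, ?_⟩
    intro j hj k hk p hp q hq p'' hp'' q'' hq''
    obtain ⟨p', hp'⟩ := vertex_exists hG s hs j hj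
    obtain ⟨q', hq'⟩ := vertex_exists hG s hs k hk
    rw [hh j hj k hk p hp q hq p' hp' q' hq', hvw, precedes_smul hpos,
      hh' j hj k hk p' hp' q' hq' p'' hp'' q'' hq'']

/-- Subscript-preserving isomorphism as an equivalence relation on the generic arrangements with
coefficient matrix `a`. -/
def subscriptSetoid {n m : ℕ} (a : Matrix (Fin n) (Fin m) ℝ) : Setoid (GenericArrangement a) where
  r H H' := SubscriptIso H.1 H'.1
  iseqv :=
    { refl := fun H => subscriptIso_refl H.2.2
      symm := fun h => subscriptIso_symm h
      trans := fun {_ H' _} h h' => subscriptIso_trans H'.2.2 h h' }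

/-- The subscript-preserving isomorphism classes. -/
def IsoClasses {n m : ℕ} (a : Matrix (Fin n) (Fin m) ℝ) : Type :=
  Quotient (subscriptSetoid a)

/-! ### Central arrangements: regions and characteristic polynomial -/

/-- The number of regions (connected components of the complement) of an arrangement of linear
subspaces of `ℝ^n`. -/
noncomputable def numRegions {n : ℕ} (A : Set (Submodule ℝ (Fin n → ℝ))) : ℕ :=
  Nat.card (ConnectedComponents ↥((⋃ X ∈ A, (X : Set (Fin n → ℝ)))ᶜ))

/-- The intersection poset of `A`: all intersections of subfamilies of `A` (the empty
intersection is the whole space), ordered by reverse inclusion. -/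
abbrev IntersectionPoset {n : ℕ} (A : Set (Submodule ℝ (Fin n → ℝ))) : Type :=
  {X : (Submodule ℝ (Fin n → ℝ))ᵒᵈ // ∃ B ⊆ A, OrderDual.ofDual X = sInf B}

instance finite_intersectionPoset {n : ℕ} (A : Set (Submodule ℝ (Fin n → ℝ))) [Finite A] :
    Finite (IntersectionPoset A) := by
  have h : (Set.range fun B : Set.powerset A => OrderDual.toDual (sInf B.1)).Finite := by
    have : Finite (Set.powerset A) := (Set.toFinite A).finite_subsets
    exact Set.finite_range _
  refine (h.subset ?_).to_subtype
  rintro X ⟨B, hB, hX⟩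
  exact ⟨⟨B, hB⟩, by simp [← hX]⟩

/-- The least element of the intersection poset, that is, the whole space. -/
def IntersectionPoset.bot {n : ℕ} (A : Set (Submodule ℝ (Fin n → ℝ))) : IntersectionPoset A :=
  ⟨OrderDual.toDual ⊤, ∅, Set.empty_subset A, by simp⟩

open Classical in
/-- The characteristic polynomial `∑ μ(0̂, X) x ^ dim X`, the sum being over the intersection
poset and `μ` its Möbius function. -/
noncomputable def charPoly {n : ℕ} (A : Set (Submodule ℝ (Fin n → ℝ))) [Finite A] :
    Polynomial ℤ :=
  letI : Fintype (IntersectionPoset A) := Fintype.ofFinite _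
  letI : LocallyFiniteOrder (IntersectionPoset A) := Fintype.toLocallyFiniteOrder
  ∑ X : IntersectionPoset A,
    Polynomial.C (IncidenceAlgebra.mu ℤ (IntersectionPoset.bot A) X) *
      Polynomial.X ^ finrank ℝ (OrderDual.ofDual X.1 : Submodule ℝ (Fin n → ℝ))

/-! ### The discriminantal arrangement -/

/-- The subsets of `{1, …, n}` of cardinality `m + 1`. -/
abbrev Circuit (n m : ℕ) : Type := {S : Finset (Fin n) // S.card = m + 1}

/-- For `S = {i₁ < ⋯ < i_{m+1}}`, the matrix with rows `(a i_k 1, …, a i_k m, y i_k)`. -/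
def augmented {n m : ℕ} (a : Matrix (Fin n) (Fin m) ℝ) (S : Circuit n m) (y : Fin n → ℝ) :
    Matrix (Fin (m + 1)) (Fin (m + 1)) ℝ :=
  Matrix.of fun k => Fin.snoc (α := fun _ => ℝ) (a (S.1.orderEmbOfFin S.2 k))
    (y (S.1.orderEmbOfFin S.2 k))

theorem augmented_eq {n m : ℕ} (a : Matrix (Fin n) (Fin m) ℝ) (S : Circuit n m)
    (y : Fin n → ℝ) :
    augmented a S y = (augmented a S 0).updateCol (Fin.last m)
      (fun k => y (S.1.orderEmbOfFin S.2 k)) := by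
  ext k l
  refine Fin.lastCases ?_ (fun l => ?_) l
  · simp [augmented]
  · simp [augmented, Fin.castSucc_ne_last]

/-- The hyperplane `M_S = {y | det (augmented a S y) = 0}` of `ℝ^n`. -/
def discHyperplane {n m : ℕ} (a : Matrix (Fin n) (Fin m) ℝ) (S : Circuit n m) :
    Submodule ℝ (Fin n → ℝ) where
  carrier := {y | (augmented a S y).det = 0}
  zero_mem' := by
    refine Matrix.det_eq_zero_of_column_eq_zero (Fin.last m) fun k => ?_
    simp [augmented]
  add_mem' := by
    intro y z hy hz
    simp only [Set.mem_ofPred_eq] at *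
    rw [augmented_eq] at hy hz ⊢
    have := Matrix.det_updateCol_add (augmented a S 0) (Fin.last m)
      (fun k => y (S.1.orderEmbOfFin S.2 k)) (fun k => z (S.1.orderEmbOfFin S.2 k))
    rw [hy, hz, add_zero] at this
    exact this
  smul_mem' := by
    intro c y hy
    simp only [Set.mem_ofPred_eq] at *
    rw [augmented_eq] at hy ⊢
    have := Matrix.det_updateCol_smul (augmented a S 0) (Fin.last m) c
      (fun k => y (S.1.orderEmbOfFin S.2 k))
    rw [hy, mul_zero] at this
    exact this

/-- The discriminantal arrangement. -/
def discArrangement {n m : ℕ} (a : Matrix (Fin n) (Fin m) ℝ) :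
    Set (Submodule ℝ (Fin n → ℝ)) :=
  Set.range (discHyperplane a)

instance finite_discArrangement {n m : ℕ} (a : Matrix (Fin n) (Fin m) ℝ) :
    Finite (discArrangement a) :=
  inferInstanceAs (Finite (Set.range (discHyperplane a)))

/-- The dimension of the intersection of the `M_S` with `S ∈ D`. -/
noncomputable def interDim {n m : ℕ} (a : Matrix (Fin n) (Fin m) ℝ) (D : Finset (Circuit n m)) :
    ℕ :=
  finrank ℝ (⨅ S ∈ D, discHyperplane a S : Submodule ℝ (Fin n → ℝ))

/-! ### Concurrency closure, base collections, concurrency free normal systems -/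

/-- The criterion that forces `S` into a concurrency closed collection containing `D`. -/
def Forced {n m : ℕ} (D : Finset (Circuit n m)) (S : Circuit n m) : Prop :=
  ∃ T ⊆ D, S ∉ T ∧
    (∀ J ⊆ T, J.Nonempty → m + J.card ≤ (J.biUnion Subtype.val).card) ∧
    (T.biUnion Subtype.val ∪ S.1).card < m + T.card + 1

def IsConcurrencyClosed {n m : ℕ} (D : Finset (Circuit n m)) : Prop :=
  ∀ S, Forced D S → S ∈ D

open Classical in
/-- One step of the closure process: add all elements that are forced by `D`. -/
noncomputable def closureStep {n m : ℕ} (D : Finset (Circuit n m)) : Finset (Circuit n m) :=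
  D ∪ Finset.univ.filter (Forced D)

open Classical in
/-- The concurrency closure: the union of the collections obtained from `D` by iterating
`closureStep`. -/
noncomputable def concClosure {n m : ℕ} (D : Finset (Circuit n m)) : Finset (Circuit n m) :=
  Finset.univ.filter fun S => ∃ k : ℕ, S ∈ closureStep^[k] D

/-- `B` is a base collection for `D`: a minimal collection with the same closure as `D`. -/
def IsBaseCollection {n m : ℕ} (B D : Finset (Circuit n m)) : Prop :=
  concClosure B = concClosure D ∧
    ∀ D' : Finset (Circuit n m), concClosure D' = concClosure D → D' ⊆ B → D' = B

/-- The cardinality of a base collection for `D` (the least one; that all base collections have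
equal cardinality is a matter of proof). -/
noncomputable def concRank {n m : ℕ} (D : Finset (Circuit n m)) : ℕ :=
  sInf {k | ∃ B, IsBaseCollection B D ∧ B.card = k}

/-- The normal system with coefficient matrix `a` is concurrency free. -/
def IsConcurrencyFree {n m : ℕ} (a : Matrix (Fin n) (Fin m) ℝ) : Prop :=
  ∀ D : Finset (Circuit n m), IsConcurrencyClosed D → ∀ B, IsBaseCollection B D →
    (B.card : ℤ) = n - interDim a D ∧ (B.card : ℤ) = n - interDim a B

end Discriminantal

/-!
The proof has three independent parts.

*Isomorphism classes.* For a circuit `S`, the determinant of `augmented a S b` is a linear form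
`discForm a S` in `b`. It vanishes on the vectors `(a i · x)_i` and all its coefficients with
subscript in `S` are nonzero. Hence the arrangement with right-hand sides `b` is generic exactly
when no form vanishes at `b` (`IsNormalMatrix.isGeneric_arr_iff`). If `S = s ∪ {j, k}`, the vertices
`p_j` and `p_k` on the line `flat s` satisfy `p_k = p_j + t • u`, where `t` is a nonzero multiple of
`discForm a S b` with a factor that does not depend on `b` (`IsNormalMatrix.precedes_iff`).
Therefore an isomorphism forces the signs of the forms at `b` and `b'` to agree, or to be opposite,
on all circuits containing a given `s`; since circuits can be exchanged one subscript at a time, the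
same alternative holds for all circuits (`IsNormalMatrix.subscriptIso_arr_iff`). So a class is a
pair of opposite cells of the discriminantal arrangement.

*Regions.* Cells are convex and open, so regions correspond to realizable sign patterns
(`numRegions_eq_card_patterns`). These are counted relative to a subspace `W` by deletion and
restriction, which yields `∑ (-1) ^ (#D + codim D)` over all subfamilies `D` (`card_patterns`).
Grouping the subfamilies by their intersection gives a function on the intersection poset with the
defining recursion of the Möbius function, whence the characteristic polynomial (`eval_charPoly`).

*Ranks.* Any collection `D` contains a base collection `B` of its closure. In
`B ⊆ D ⊆ concClosure D` the two extremes have intersections of codimension `#B`, because the normal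
system is concurrency free; so `D` has it too (`IsConcurrencyFree.card_eq`).
-/

namespace Discriminantal

open Module

/-! ### Counting the cells of a family of linear functionals -/

section Cells

variable {ι V : Type*} [AddCommGroup V] [Module ℝ V]

/-- `y` lies in the open cell on which the functionals `f i`, `i ∈ s`, are positive for `i ∈ P` and
negative for `i ∉ P`. -/
def InCell (f : ι → V →ₗ[ℝ] ℝ) (s P : Finset ι) (y : V) : Prop :=
  ∀ i ∈ s, (i ∈ P → 0 < f i y) ∧ (i ∉ P → f i y < 0)

theorem inCell_insert [DecidableEq ι] {f : ι → V →ₗ[ℝ] ℝ} {s P : Finset ι} {i : ι} {y : V} :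
    InCell f (insert i s) P y ↔
      ((i ∈ P → 0 < f i y) ∧ (i ∉ P → f i y < 0)) ∧ InCell f s P y := by
  simp [InCell]

theorem inCell_congr {f : ι → V →ₗ[ℝ] ℝ} {s P Q : Finset ι} {y : V}
    (h : ∀ i ∈ s, (i ∈ P ↔ i ∈ Q)) : InCell f s P y ↔ InCell f s Q y := by
  unfold InCell
  refine forall₂_congr fun i hi => ?_
  rw [h i hi]

/-- Open cells are stable under small perturbations. -/
theorem InCell.eventually {f : ι → V →ₗ[ℝ] ℝ} {s P : Finset ι} {y : V} (h : InCell f s P y)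
    (w : V) : ∀ᶠ t : ℝ in nhds 0, InCell f s P (y + t • w) := by
  unfold InCell
  rw [Filter.eventually_all_finset]
  intro i hi
  have hc : ContinuousAt (fun t : ℝ => f i (y + t • w)) 0 := by
    simp only [map_add, map_smul, smul_eq_mul]
    fun_prop
  by_cases hP : i ∈ P
  · have h0 : 0 < f i (y + (0 : ℝ) • w) := by simpa using (h i hi).1 hP
    filter_upwards [hc.eventually (lt_mem_nhds h0)] with t ht
    exact ⟨fun _ => ht, fun h' => absurd hP h'⟩
  · have h0 : f i (y + (0 : ℝ) • w) < 0 := by simpa using (h i hi).2 hP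
    filter_upwards [hc.eventually (gt_mem_nhds h0)] with t ht
    exact ⟨fun h' => absurd h' hP, fun _ => ht⟩

theorem InCell.exists_pos {f : ι → V →ₗ[ℝ] ℝ} {s P : Finset ι} {y : V} (h : InCell f s P y)
    (w : V) : ∃ t : ℝ, 0 < t ∧ InCell f s P (y + t • w) := by
  obtain ⟨t, ht, hpos⟩ := (((h.eventually w).filter_mono nhdsWithin_le_nhds).and
    (self_mem_nhdsWithin (a := (0 : ℝ)) (s := Set.Ioi 0))).exists
  exact ⟨t, hpos, ht⟩

theorem convex_inCell (f : ι → V →ₗ[ℝ] ℝ) (s P : Finset ι) : Convex ℝ {y | InCell f s P y} := by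
  have : {y | InCell f s P y} = ⋂ i ∈ s, ({y | i ∈ P → 0 < f i y} ∩ {y | i ∉ P → f i y < 0}) := by
    ext y; simp [InCell]
  rw [this]
  refine convex_iInter₂ fun i _ => ?_
  by_cases hP : i ∈ P
  · simpa [hP] using convex_halfSpace_gt (f i).isLinear 0
  · simpa [hP] using convex_halfSpace_lt (f i).isLinear 0

open Classical in
/-- The sign patterns of the nonempty cells that the functionals `f i`, `i ∈ s`, cut out of `W`;
a pattern is recorded as the set of indices with positive sign. -/
noncomputable def patterns (f : ι → V →ₗ[ℝ] ℝ) (W : Submodule ℝ V) (s : Finset ι) :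
    Finset (Finset ι) :=
  s.powerset.filter fun P => ∃ y ∈ W, InCell f s P y

theorem mem_patterns {f : ι → V →ₗ[ℝ] ℝ} {W : Submodule ℝ V} {s P : Finset ι} :
    P ∈ patterns f W s ↔ P ⊆ s ∧ ∃ y ∈ W, InCell f s P y := by
  simp [patterns]

open Classical in
/-- Deletion and restriction: a hyperplane splits exactly those cells that it meets. -/
theorem card_patterns_insert (f : ι → V →ₗ[ℝ] ℝ) (W : Submodule ℝ V) {s : Finset ι} {i : ι}
    (hi : i ∉ s) (hW : ∃ w ∈ W, f i w ≠ 0) :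
    (patterns f W (insert i s)).card =
      (patterns f W s).card + (patterns f (W ⊓ LinearMap.ker (f i)) s).card := by
  obtain ⟨w, hwW, hw⟩ : ∃ w ∈ W, 0 < f i w := by
    obtain ⟨w, hwW, hw⟩ := hW
    rcases lt_or_gt_of_ne hw with h | h
    · exact ⟨-w, W.neg_mem hwW, by simpa using h⟩
    · exact ⟨w, hwW, h⟩
  set A := (patterns f W s).filter fun P => ∃ y ∈ W, InCell f s P y ∧ f i y < 0 with hA
  set B := (patterns f W s).filter fun P => ∃ y ∈ W, InCell f s P y ∧ 0 < f i y with hB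
  have hins : ∀ {P y}, InCell f s (insert i P) y ↔ InCell f s P y := fun {P y} =>
    inCell_congr fun j hj => by
      have : j ≠ i := fun h => hi (h ▸ hj)
      simp [this]
  have hsplit : patterns f W (insert i s) = A ∪ B.image (insert i) := by
    ext P
    simp only [mem_patterns, Finset.mem_union, Finset.mem_image, hA, hB, Finset.mem_filter]
    constructor
    · rintro ⟨hP, y, hy, hc⟩
      rw [inCell_insert] at hc
      by_cases hiP : i ∈ P
      · refine Or.inr ⟨P.erase i, ⟨⟨?_, y, hy, ?_⟩, y, hy, ?_, hc.1.1 hiP⟩, Finset.insert_erase hiP⟩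
        · rwa [Finset.subset_insert_iff] at hP
        · rw [← hins, Finset.insert_erase hiP]; exact hc.2
        · rw [← hins, Finset.insert_erase hiP]; exact hc.2
      · exact Or.inl ⟨⟨(Finset.subset_insert_iff_of_notMem hiP).mp hP, y, hy, hc.2⟩, y, hy, hc.2,
          hc.1.2 hiP⟩
    · rintro (⟨⟨hP, -⟩, y, hy, hc, hlt⟩ | ⟨Q, ⟨⟨hQ, -⟩, y, hy, hc, hlt⟩, rfl⟩)
      · refine ⟨hP.trans (Finset.subset_insert _ _), y, hy,
          inCell_insert.mpr ⟨⟨?_, fun _ => hlt⟩, hc⟩⟩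
        exact fun h => absurd (hP h) hi
      · exact ⟨Finset.insert_subset_insert _ hQ, y, hy, inCell_insert.mpr
          ⟨⟨fun _ => hlt, fun h => absurd (Finset.mem_insert_self _ _) h⟩, hins.mpr hc⟩⟩
  have hsub : ∀ {P}, P ∈ A ∨ P ∈ B → i ∉ P := by
    rintro P h hP
    have : P ∈ patterns f W s := by
      rcases h with h | h <;> exact (Finset.mem_filter.mp h).1
    exact hi ((mem_patterns.mp this).1 hP)
  have hdisj : Disjoint A (B.image (insert i)) := by
    rw [Finset.disjoint_left]
    intro P hPA hPB
    obtain ⟨Q, -, rfl⟩ := Finset.mem_image.mp hPB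
    exact hsub (Or.inl hPA) (Finset.mem_insert_self _ _)
  have hinj : Set.InjOn (insert i) (B : Set (Finset ι)) := by
    intro P hP Q hQ h
    rw [← Finset.erase_insert (hsub (Or.inr hP)), ← Finset.erase_insert (hsub (Or.inr hQ))]
    exact congrArg (fun t => Finset.erase t i) h
  have hunion : A ∪ B = patterns f W s := by
    refine Finset.Subset.antisymm
      (Finset.union_subset (Finset.filter_subset _ _) (Finset.filter_subset _ _)) fun P hP => ?_
    obtain ⟨-, y, hy, hc⟩ := mem_patterns.mp hP
    rcases lt_trichotomy (f i y) 0 with h | h | h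
    · exact Finset.mem_union_left _ (Finset.mem_filter.mpr ⟨hP, y, hy, hc, h⟩)
    · obtain ⟨t, ht, hct⟩ := hc.exists_pos w
      refine Finset.mem_union_right _ (Finset.mem_filter.mpr
        ⟨hP, _, W.add_mem hy (W.smul_mem t hwW), hct, ?_⟩)
      simp only [map_add, map_smul, h, smul_eq_mul, zero_add]
      positivity
    · exact Finset.mem_union_right _ (Finset.mem_filter.mpr ⟨hP, y, hy, hc, h⟩)
  have hinter : A ∩ B = patterns f (W ⊓ LinearMap.ker (f i)) s := by
    ext P
    simp only [mem_patterns, Finset.mem_inter, hA, hB, Finset.mem_filter, Submodule.mem_inf,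
      LinearMap.mem_ker]
    constructor
    · rintro ⟨⟨⟨hP, -⟩, y, hy, hcy, hy0⟩, -, z, hz, hcz, hz0⟩
      -- the segment from `y` to `z` stays in the cell and crosses the hyperplane
      have hd : 0 < f i z - f i y := by linarith
      refine ⟨hP, (f i z / (f i z - f i y)) • y + (-f i y / (f i z - f i y)) • z,
        ⟨W.add_mem (W.smul_mem _ hy) (W.smul_mem _ hz), ?_⟩, ?_⟩
      · simp only [map_add, map_smul, smul_eq_mul]
        ring
      · refine convex_inCell f s P hcy hcz (by positivity)
          (div_nonneg (by linarith) hd.le) ?_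
        field_simp
        ring
    · rintro ⟨hP, y, ⟨hy, hy0⟩, hc⟩
      obtain ⟨t, ht, hct⟩ := hc.exists_pos w
      obtain ⟨t', ht', hct'⟩ := hc.exists_pos (-w)
      refine ⟨⟨⟨hP, y, hy, hc⟩, _, W.add_mem hy (W.smul_mem t' (W.neg_mem hwW)), hct', ?_⟩,
        ⟨hP, y, hy, hc⟩, _, W.add_mem hy (W.smul_mem t hwW), hct, ?_⟩
      · simp only [map_add, map_smul, map_neg, hy0, smul_eq_mul, zero_add]
        nlinarith
      · simp only [map_add, map_smul, hy0, smul_eq_mul, zero_add]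
        positivity
  rw [hsplit, Finset.card_union_of_disjoint hdisj, Finset.card_image_of_injOn hinj, ← hunion,
    ← hinter, Finset.card_union_add_card_inter]

/-- The number of cells as an alternating sum over subfamilies. Functionals vanishing on `W` are
allowed; both sides are then `0`. -/
theorem card_patterns [FiniteDimensional ℝ V] (f : ι → V →ₗ[ℝ] ℝ) (W : Submodule ℝ V)
    (s : Finset ι) :
    ((patterns f W s).card : ℤ) = ∑ D ∈ s.powerset,
      (-1 : ℤ) ^ (D.card + finrank ℝ W +
        finrank ℝ (W ⊓ ⨅ i ∈ D, LinearMap.ker (f i) : Submodule ℝ V)) := by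
  classical
  induction s using Finset.induction_on generalizing W with
  | empty =>
    have : patterns f W ∅ = {∅} := by
      ext P
      simp only [mem_patterns, Finset.subset_empty, Finset.mem_singleton, and_iff_left_iff_imp]
      exact fun _ => ⟨0, W.zero_mem, by simp [InCell]⟩
    rw [this, Finset.powerset_empty, Finset.sum_singleton]
    have h0 : (W ⊓ ⨅ i ∈ (∅ : Finset ι), LinearMap.ker (f i)) = W := by simp
    rw [h0, Finset.card_empty, zero_add, Even.neg_one_pow ⟨_, rfl⟩, Finset.card_singleton,
      Nat.cast_one]
  | insert i s hi ih =>
    rw [Finset.sum_powerset_insert hi]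
    have hcard : ∀ D ∈ s.powerset, (insert i D).card = D.card + 1 := fun D hD =>
      Finset.card_insert_of_notMem fun h => hi (Finset.mem_powerset.mp hD h)
    by_cases hW : ∃ w ∈ W, f i w ≠ 0
    · rw [card_patterns_insert f W hi hW, Nat.cast_add, ih, ih]
      congr 1
      refine Finset.sum_congr rfl fun D hD => ?_
      have hker : finrank ℝ W = finrank ℝ (W ⊓ LinearMap.ker (f i) : Submodule ℝ V) + 1 := by
        obtain ⟨w, hw, hw0⟩ := hW
        have h0 : (f i).domRestrict W ≠ 0 := fun h => hw0 (by
          simpa using LinearMap.congr_fun h ⟨w, hw⟩)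
        rw [← Module.Dual.finrank_ker_add_one_of_ne_zero (f := (f i).domRestrict W) h0]
        rw [LinearMap.ker_domRestrict, ← Submodule.map_comap_subtype,
          Submodule.finrank_map_subtype_eq]
      rw [hcard D hD, Finset.iInf_insert, hker, inf_assoc]
      ring
    · push Not at hW
      have hle : W ≤ LinearMap.ker (f i) := fun w hw => hW w hw
      have hempty : patterns f W (insert i s) = ∅ := by
        refine Finset.eq_empty_of_forall_notMem fun P hP => ?_
        obtain ⟨-, y, hy, hc⟩ := mem_patterns.mp hP
        have := hc i (Finset.mem_insert_self _ _)
        rw [hW y hy] at this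
        by_cases hiP : i ∈ P
        · exact lt_irrefl _ (this.1 hiP)
        · exact lt_irrefl _ (this.2 hiP)
      rw [hempty, ← Finset.sum_add_distrib, Finset.card_empty, Nat.cast_zero]
      refine (Finset.sum_eq_zero fun D hD => ?_).symm
      rw [hcard D hD, Finset.iInf_insert, ← inf_assoc, inf_eq_left.mpr hle]
      ring

theorem InCell.ne_zero [Fintype ι] {f : ι → V →ₗ[ℝ] ℝ} {P : Finset ι} {y : V}
    (h : InCell f Finset.univ P y) (i : ι) :
    f i y ≠ 0 := by
  by_cases hP : i ∈ P
  · exact ((h i (Finset.mem_univ i)).1 hP).ne'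
  · exact ((h i (Finset.mem_univ i)).2 hP).ne

theorem InCell.pos_iff [Fintype ι] {f : ι → V →ₗ[ℝ] ℝ} {P : Finset ι} {y : V}
    (h : InCell f Finset.univ P y) (i : ι) :
    0 < f i y ↔ i ∈ P :=
  ⟨fun hi => by_contra fun hP => lt_asymm hi ((h i (Finset.mem_univ i)).2 hP),
    (h i (Finset.mem_univ i)).1⟩

theorem InCell.neg [Fintype ι] [DecidableEq ι] {f : ι → V →ₗ[ℝ] ℝ} {P : Finset ι} {y : V}
    (h : InCell f Finset.univ P y) :
    InCell f Finset.univ Pᶜ (-y) := by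
  intro i hi
  simp only [Finset.mem_compl, not_not, map_neg, neg_pos, neg_lt_zero]
  exact ⟨(h i hi).2, (h i hi).1⟩

theorem inCell_filter_pos [Fintype ι] {f : ι → V →ₗ[ℝ] ℝ} {y : V}
    [DecidablePred fun i => 0 < f i y] (hy : ∀ i, f i y ≠ 0) :
    InCell f Finset.univ (Finset.univ.filter fun i => 0 < f i y) y := by
  intro i _
  simp only [Finset.mem_filter, Finset.mem_univ, true_and, imp_self, not_lt]
  exact fun h => lt_of_le_of_ne h (hy i)

/-- A central arrangement is symmetric about the origin, so exactly half of its cells lie on the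
positive side of any given member. -/
theorem card_patterns_eq_two_mul [Fintype ι] [DecidableEq ι] (f : ι → V →ₗ[ℝ] ℝ) (i : ι) :
    (patterns f ⊤ Finset.univ).card =
      2 * ((patterns f ⊤ Finset.univ).filter fun P => i ∈ P).card := by
  rw [← Finset.card_filter_add_card_filter_not (s := patterns f ⊤ Finset.univ) (fun P => i ∈ P),
    two_mul]
  congr 1
  have hcompl : ∀ P ∈ patterns f ⊤ Finset.univ, Pᶜ ∈ patterns f ⊤ Finset.univ := by
    intro P hP
    obtain ⟨-, y, -, hy⟩ := mem_patterns.mp hP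
    exact mem_patterns.mpr ⟨Finset.subset_univ _, -y, Submodule.mem_top, hy.neg⟩
  refine Finset.card_nbij' compl compl ?_ ?_ ?_ ?_
  · intro P hP
    simp only [Finset.coe_filter, Set.mem_ofPred_eq] at hP ⊢
    exact ⟨hcompl P hP.1, Finset.mem_compl.mpr hP.2⟩
  · intro P hP
    simp only [Finset.coe_filter, Set.mem_ofPred_eq] at hP ⊢
    exact ⟨hcompl P hP.1, fun h => Finset.mem_compl.mp h hP.2⟩
  · exact fun P _ => compl_compl P
  · exact fun P _ => compl_compl P

end Cells

/-! ### Regions of a hyperplane arrangement -/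

/-- The regions of the arrangement of the kernels of finitely many functionals correspond to the
realizable sign patterns, because each cell is convex and the pattern is locally constant. -/
theorem numRegions_eq_card_patterns {n : ℕ} {ι : Type*} [Fintype ι]
    (f : ι → (Fin n → ℝ) →ₗ[ℝ] ℝ) :
    numRegions (Set.range fun i => LinearMap.ker (f i)) =
      (patterns f ⊤ Finset.univ).card := by
  classical
  set X : Set (Fin n → ℝ) :=
    (⋃ Y ∈ Set.range fun i => LinearMap.ker (f i), (Y : Set (Fin n → ℝ)))ᶜ with hX
  have hXne : ∀ x : X, ∀ i, f i x ≠ 0 := by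
    rintro ⟨x, hx⟩ i
    simp only [hX, Set.mem_range, Set.iUnion_exists, Set.iUnion_iUnion_eq', Set.compl_iUnion,
      Set.mem_iInter, Set.mem_compl_iff, SetLike.mem_coe, LinearMap.mem_ker] at hx
    exact hx i
  let p : X → Finset ι := fun x => Finset.univ.filter fun i => 0 < f i x
  have hp : ∀ (x : X) P, p x = P ↔ InCell f Finset.univ P (x : Fin n → ℝ) := by
    intro x P
    constructor
    · rintro rfl
      exact inCell_filter_pos (hXne x)
    · intro h
      ext i
      simp only [p, Finset.mem_filter, Finset.mem_univ, true_and]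
      exact h.pos_iff i
  have hf : ∀ i, Continuous (f i) := fun i => (f i).continuous_of_finiteDimensional
  have hcell_open : ∀ P, IsOpen {y | InCell f Finset.univ P y} := by
    intro P
    have : {y | InCell f Finset.univ P y} =
        ⋂ i, ({y | i ∈ P → 0 < f i y} ∩ {y | i ∉ P → f i y < 0}) := by
      ext y; simp [InCell]
    rw [this]
    refine isOpen_iInter_of_finite fun i => ?_
    by_cases hP : i ∈ P
    · simpa [hP] using isOpen_lt continuous_const (hf i)
    · simpa [hP] using isOpen_lt (hf i) continuous_const
  have hcell_sub : ∀ P, {y | InCell f Finset.univ P y} ⊆ X := by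
    intro P y hy
    simp only [hX, Set.mem_range, Set.iUnion_exists, Set.iUnion_iUnion_eq', Set.compl_iUnion,
      Set.mem_iInter, Set.mem_compl_iff, SetLike.mem_coe, LinearMap.mem_ker]
    exact hy.ne_zero
  have hfib : ∀ P, p ⁻¹' {P} = Subtype.val ⁻¹' {y | InCell f Finset.univ P y} := by
    intro P
    ext x
    exact hp x P
  have hloc : IsLocallyConstant p := by
    rw [IsLocallyConstant.iff_isOpen_fiber]
    intro P
    have := (hcell_open P).preimage (continuous_subtype_val (p := (· ∈ X)))
    rw [← hfib P] at this
    exact this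
  have hconn : ∀ x y : X, (x : ConnectedComponents X) = y ↔ p x = p y := by
    intro x y
    rw [ConnectedComponents.coe_eq_coe']
    constructor
    · intro h
      exact hloc.apply_eq_of_isPreconnected isPreconnected_connectedComponent h
        mem_connectedComponent |>.symm ▸ rfl
    · intro h
      have hpre : IsPreconnected (p ⁻¹' {p y}) := by
        rw [hfib, ← Topology.IsInducing.subtypeVal.isPreconnected_image,
          Subtype.image_preimage_coe, Set.inter_eq_right.mpr (hcell_sub _)]
        exact (convex_inCell f _ _).isPreconnected
      exact hpre.subset_connectedComponent rfl h
  let g : ConnectedComponents X → (patterns f ⊤ (Finset.univ : Finset ι)) :=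
    Quotient.lift (fun x => ⟨p x, mem_patterns.mpr
      ⟨Finset.subset_univ _, x, Submodule.mem_top, (hp x _).mp rfl⟩⟩)
      fun x y h => Subtype.ext ((hconn x y).mp (Quotient.sound h))
  have hg : Function.Bijective g := by
    constructor
    · rintro ⟨x⟩ ⟨y⟩ h
      exact (hconn x y).mpr (congrArg Subtype.val h)
    · rintro ⟨P, hP⟩
      obtain ⟨-, y, -, hy⟩ := mem_patterns.mp hP
      exact ⟨((⟨y, hcell_sub P hy⟩ : X) : ConnectedComponents X), Subtype.ext ((hp _ _).mpr hy)⟩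
  rw [numRegions, Nat.card_eq_of_bijective g hg, Nat.card_eq_fintype_card, Fintype.card_coe]

/-- Zaslavsky's formula for the number of regions of a central arrangement. -/
theorem numRegions_eq_sum {n : ℕ} {ι : Type*} [Fintype ι] (f : ι → (Fin n → ℝ) →ₗ[ℝ] ℝ) :
    (numRegions (Set.range fun i => LinearMap.ker (f i)) : ℤ) =
      ∑ D : Finset ι, (-1) ^ (n + D.card +
        finrank ℝ (⨅ i ∈ D, LinearMap.ker (f i) : Submodule ℝ (Fin n → ℝ))) := by
  rw [numRegions_eq_card_patterns, card_patterns, Finset.powerset_univ]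
  refine Finset.sum_congr rfl fun D _ => ?_
  rw [top_inf_eq, finrank_top, Module.finrank_fin_fun, add_comm D.card]

/-! ### The characteristic polynomial as a sum over subfamilies -/

open Classical in
/-- Whitney's formula. The function `X ↦ ∑ (-1) ^ #D`, summed over the `D` with intersection `X`,
satisfies the recursion that defines the Möbius function `μ(0̂, X)`. -/
theorem eval_charPoly {n : ℕ} {ι : Type*} [Fintype ι] (M : ι → Submodule ℝ (Fin n → ℝ))
    (hM : ∀ i, M i ≠ ⊤) (x : ℤ) :
    (charPoly (Set.range M)).eval x =
      ∑ D : Finset ι, (-1) ^ D.card * x ^ finrank ℝ (⨅ i ∈ D, M i : Submodule ℝ (Fin n → ℝ)) := by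
  let _ : Fintype (IntersectionPoset (Set.range M)) := Fintype.ofFinite _
  let _ : LocallyFiniteOrder (IntersectionPoset (Set.range M)) := Fintype.toLocallyFiniteOrder
  let F : Finset ι → IntersectionPoset (Set.range M) := fun D =>
    ⟨OrderDual.toDual (⨅ i ∈ D, M i), M '' D, Set.image_subset_range _ _, by
      simp [sInf_image]⟩
  let w : IntersectionPoset (Set.range M) → ℤ := fun X =>
    ∑ D : Finset ι with F D = X, (-1) ^ D.card
  have hle : ∀ D X, F D ≤ X ↔ ∀ i ∈ D, OrderDual.ofDual X.1 ≤ M i := by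
    intro D X
    change OrderDual.ofDual X.1 ≤ (⨅ i ∈ D, M i) ↔ _
    simp
  have hbot : ∀ X, IntersectionPoset.bot (Set.range M) ≤ X := fun X =>
    (le_top : OrderDual.ofDual X.1 ≤ ⊤)
  have hsum : ∀ X, ∑ Y ∈ Finset.Icc (IntersectionPoset.bot (Set.range M)) X, w Y =
      if IntersectionPoset.bot (Set.range M) = X then 1 else 0 := by
    intro X
    have h1 : ∑ Y ∈ Finset.Icc (IntersectionPoset.bot (Set.range M)) X, w Y =
        ∑ D ∈ (Finset.univ.filter fun i => OrderDual.ofDual X.1 ≤ M i).powerset,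
          (-1 : ℤ) ^ D.card := by
      have h2 : (Finset.univ.filter fun i => OrderDual.ofDual X.1 ≤ M i).powerset =
          Finset.univ.filter fun D => F D ∈ Finset.Icc (IntersectionPoset.bot (Set.range M)) X := by
        ext D
        simp only [Finset.mem_powerset, Finset.mem_filter, Finset.mem_univ, true_and,
          Finset.mem_Icc, hbot, hle, Finset.subset_iff]
      rw [h2, ← Finset.sum_fiberwise_of_maps_to (g := F)
        (t := Finset.Icc (IntersectionPoset.bot (Set.range M)) X)
        (fun D hD => (Finset.mem_filter.mp hD).2)]
      refine Finset.sum_congr rfl fun Y hY => ?_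
      refine Finset.sum_congr ?_ fun _ _ => rfl
      ext D
      simp only [Finset.mem_filter, Finset.mem_univ, true_and]
      exact ⟨fun h => ⟨h ▸ hY, h⟩, fun h => h.2⟩
    rw [h1, Finset.sum_powerset_neg_one_pow_card]
    refine if_congr ?_ rfl rfl
    rw [Finset.filter_eq_empty_iff]
    constructor
    · intro h
      obtain ⟨X, B, hB, hX⟩ := X
      have hBe : B = ∅ := by
        refine Set.eq_empty_of_forall_notMem fun Y hY => ?_
        obtain ⟨i, rfl⟩ := hB hY
        exact h (Finset.mem_univ i) (hX.trans_le (sInf_le hY))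
      refine Subtype.ext ?_
      subst hBe
      rw [sInf_empty] at hX
      exact hX.symm
    · rintro rfl i - h
      exact hM i (top_le_iff.mp h)
  have hmu : ∀ X, IncidenceAlgebra.mu ℤ (IntersectionPoset.bot (Set.range M)) X = w X := by
    intro X
    induction X using WellFoundedLT.induction with
    | ind X ih =>
      rw [IncidenceAlgebra.mu_apply, Finset.sum_congr rfl fun Y hY => ih Y (Finset.mem_Ico.mp hY).2]
      have h := hsum X
      rw [← Finset.Ico_insert_right (hbot X), Finset.sum_insert (by simp)] at h
      split_ifs at h ⊢ with h0
      · rw [← h0, Finset.Ico_self, Finset.sum_empty, add_zero, h0] at h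
        exact h.symm
      · linarith
  have hdef : charPoly (Set.range M) = ∑ X : IntersectionPoset (Set.range M),
      Polynomial.C (IncidenceAlgebra.mu ℤ (IntersectionPoset.bot (Set.range M)) X) *
      Polynomial.X ^ finrank ℝ (OrderDual.ofDual X.1 : Submodule ℝ (Fin n → ℝ)) := rfl
  rw [hdef, Polynomial.eval_finsetSum, ← Finset.sum_fiberwise (g := F)]
  refine Finset.sum_congr rfl fun X _ => ?_
  rw [hmu, Polynomial.eval_mul, Polynomial.eval_C, Polynomial.eval_pow, Polynomial.eval_X,
    Finset.sum_mul]
  refine Finset.sum_congr rfl fun D hD => ?_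
  rw [← (Finset.mem_filter.mp hD).2]
  rfl

/-! ### The concurrency closure -/

section Closure

variable {n m : ℕ} {D D' B : Finset (Circuit n m)}

theorem subset_closureStep (D : Finset (Circuit n m)) : D ⊆ closureStep D :=
  Finset.subset_union_left

theorem mem_closureStep {S : Circuit n m} : S ∈ closureStep D ↔ S ∈ D ∨ Forced D S := by
  simp [closureStep]

theorem iterate_closureStep_mono (D : Finset (Circuit n m)) :
    Monotone fun k => closureStep^[k] D := by
  refine monotone_nat_of_le_succ fun k => ?_
  rw [Function.iterate_succ_apply']
  exact subset_closureStep _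

theorem mem_concClosure {S : Circuit n m} :
    S ∈ concClosure D ↔ ∃ k : ℕ, S ∈ closureStep^[k] D := by
  simp [concClosure]

theorem subset_concClosure (D : Finset (Circuit n m)) : D ⊆ concClosure D :=
  fun _ hS => mem_concClosure.mpr ⟨0, hS⟩

theorem isConcurrencyClosed_concClosure (D : Finset (Circuit n m)) :
    IsConcurrencyClosed (concClosure D) := by
  rintro S ⟨T, hT, h⟩
  have hex : ∀ U, ∃ k : ℕ, U ∈ T → U ∈ closureStep^[k] D := fun U => by
    by_cases hU : U ∈ T
    · obtain ⟨k, hk⟩ := mem_concClosure.mp (hT hU)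
      exact ⟨k, fun _ => hk⟩
    · exact ⟨0, fun h' => absurd h' hU⟩
  choose k hk using hex
  -- the finitely many members of `T` all appear at a common stage
  have hT' : T ⊆ closureStep^[T.sup k] D := fun U hU =>
    iterate_closureStep_mono D (Finset.le_sup hU) (hk U hU)
  refine mem_concClosure.mpr ⟨T.sup k + 1, ?_⟩
  rw [Function.iterate_succ_apply', mem_closureStep]
  exact Or.inr ⟨T, hT', h⟩

theorem IsConcurrencyClosed.concClosure_eq (h : IsConcurrencyClosed D) : concClosure D = D := by
  have hstep : closureStep D = D := by
    ext S
    rw [mem_closureStep, or_iff_left_of_imp (h S)]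
  refine Finset.Subset.antisymm (fun S hS => ?_) (subset_concClosure D)
  obtain ⟨k, hk⟩ := mem_concClosure.mp hS
  rwa [Function.iterate_fixed hstep] at hk

theorem exists_isBaseCollection_subset (D : Finset (Circuit n m)) :
    ∃ B ⊆ D, IsBaseCollection B (concClosure D) := by
  classical
  obtain ⟨B, hBD, hB⟩ := exists_minimal_le_of_wellFoundedLT
    (fun B : Finset (Circuit n m) => concClosure B = concClosure D) D rfl
  refine ⟨B, hBD, ?_⟩
  rw [IsBaseCollection, (isConcurrencyClosed_concClosure D).concClosure_eq]
  exact ⟨hB.prop, fun D' hD' hsub => hB.eq_of_le hD' hsub⟩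

theorem interDim_anti (a : Matrix (Fin n) (Fin m) ℝ) (h : D ⊆ D') :
    interDim a D' ≤ interDim a D :=
  Submodule.finrank_mono (biInf_mono fun _ hS => h hS)

variable {a : Matrix (Fin n) (Fin m) ℝ}

/-- All base collections for the closure of `D` have the same cardinality, the codimension of the
intersection of the `discHyperplane a S` over `S ∈ D` itself. -/
theorem IsConcurrencyFree.card_eq (hfree : IsConcurrencyFree a)
    (hB : IsBaseCollection B (concClosure D)) : (B.card : ℤ) = n - interDim a D := by
  obtain ⟨B₀, hB₀D, hB₀⟩ := exists_isBaseCollection_subset D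
  have h := (hfree _ (isConcurrencyClosed_concClosure D) B hB).1
  have h₀ := hfree _ (isConcurrencyClosed_concClosure D) B₀ hB₀
  -- `B₀ ⊆ D ⊆ concClosure D`, and the two extremes have intersections of equal dimension
  have h1 := interDim_anti a hB₀D
  have h2 := interDim_anti a (subset_concClosure D)
  omega

theorem IsConcurrencyFree.concRank_eq (hfree : IsConcurrencyFree a)
    (D : Finset (Circuit n m)) : (concRank (concClosure D) : ℤ) = n - interDim a D := by
  obtain ⟨B₀, -, hB₀⟩ := exists_isBaseCollection_subset D
  obtain ⟨B, hB, hcard⟩ : concRank (concClosure D) ∈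
      {k | ∃ B, IsBaseCollection B (concClosure D) ∧ B.card = k} :=
    Nat.sInf_mem ⟨B₀.card, B₀, hB₀, rfl⟩
  rw [← hcard, hfree.card_eq hB]

end Closure

/-! ### Linear algebra of a matrix in general position -/

section Geometry

open scoped Matrix

variable {n m : ℕ}

/-- Any at most `m` rows of the matrix are linearly independent. -/
def IsNormalMatrix (a : Matrix (Fin n) (Fin m) ℝ) : Prop :=
  ∀ s : Finset (Fin n), s.card ≤ m → LinearIndependent ℝ fun i : s => a i

/-- The linear map `x ↦ (a i · x)_{i ∈ s}`. -/
noncomputable def rowMap (a : Matrix (Fin n) (Fin m) ℝ) (s : Finset (Fin n)) :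
    (Fin m → ℝ) →ₗ[ℝ] (s → ℝ) :=
  (Matrix.of fun i : s => a i).mulVecLin

theorem rowMap_apply (a : Matrix (Fin n) (Fin m) ℝ) (s : Finset (Fin n)) (x : Fin m → ℝ) (i : s) :
    rowMap a s x i = a i ⬝ᵥ x := rfl

theorem mem_ker_rowMap {a : Matrix (Fin n) (Fin m) ℝ} {s : Finset (Fin n)} {x : Fin m → ℝ} :
    x ∈ LinearMap.ker (rowMap a s) ↔ ∀ i ∈ s, a i ⬝ᵥ x = 0 := by
  rw [LinearMap.mem_ker, funext_iff]
  simp [rowMap_apply]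

variable {a : Matrix (Fin n) (Fin m) ℝ}

theorem IsNormalMatrix.finrank_range_rowMap (ha : IsNormalMatrix a) {s : Finset (Fin n)}
    (hs : s.card ≤ m) : finrank ℝ (LinearMap.range (rowMap a s)) = s.card := by
  have h : (Matrix.of fun i : s => a i).rank = Fintype.card s :=
    LinearIndependent.rank_matrix (ha s hs)
  rw [Fintype.card_coe] at h
  exact h

theorem IsNormalMatrix.exists_solution (ha : IsNormalMatrix a) {s : Finset (Fin n)}
    (hs : s.card ≤ m) (b : Fin n → ℝ) : ∃ x, ∀ i ∈ s, a i ⬝ᵥ x = b i := by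
  have htop : LinearMap.range (rowMap a s) = ⊤ :=
    Submodule.eq_top_of_finrank_eq (by rw [ha.finrank_range_rowMap hs]; simp)
  obtain ⟨x, hx⟩ := LinearMap.range_eq_top.mp htop fun i => b i
  exact ⟨x, fun i hi => congrFun hx ⟨i, hi⟩⟩

theorem IsNormalMatrix.finrank_ker_rowMap (ha : IsNormalMatrix a) {s : Finset (Fin n)}
    (hs : s.card ≤ m) : finrank ℝ (LinearMap.ker (rowMap a s)) = m - s.card := by
  have h := LinearMap.finrank_range_add_finrank_ker (rowMap a s)
  rw [ha.finrank_range_rowMap hs, Module.finrank_fin_fun] at h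
  omega

theorem IsNormalMatrix.eq_zero (ha : IsNormalMatrix a) {s : Finset (Fin n)} (hs : s.card = m)
    {x : Fin m → ℝ} (hx : ∀ i ∈ s, a i ⬝ᵥ x = 0) : x = 0 := by
  have h := ha.finrank_ker_rowMap hs.le
  rw [hs, Nat.sub_self, Submodule.finrank_eq_zero] at h
  simpa [h] using mem_ker_rowMap.mpr hx

theorem IsNormalMatrix.eq_of_eq (ha : IsNormalMatrix a) {s : Finset (Fin n)} (hs : s.card = m)
    {x y : Fin m → ℝ} (h : ∀ i ∈ s, a i ⬝ᵥ x = a i ⬝ᵥ y) : x = y :=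
  sub_eq_zero.mp <| ha.eq_zero hs fun i hi => by rw [dotProduct_sub, h i hi, sub_self]

theorem IsNormalMatrix.dotProduct_ne_zero (ha : IsNormalMatrix a) {s : Finset (Fin n)}
    (hs : s.card + 1 = m) {k : Fin n} (hk : k ∉ s) {u : Fin m → ℝ} (hu : u ≠ 0)
    (hus : ∀ i ∈ s, a i ⬝ᵥ u = 0) : a k ⬝ᵥ u ≠ 0 := by
  intro h
  refine hu (ha.eq_zero (s := insert k s) (by rw [Finset.card_insert_of_notMem hk, hs]) ?_)
  intro i hi
  rcases Finset.mem_insert.mp hi with rfl | hi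
  · exact h
  · exact hus i hi

theorem IsNormalSystem.isNormalMatrix {L : Fin n → Submodule ℝ (Fin m → ℝ)}
    (hL : IsNormalSystem L) (ha : IsCoeffMatrix a L) : IsNormalMatrix a :=
  hL.linearIndependent a ha

/-! ### The linear forms defining the discriminantal arrangement -/

/-- The determinant whose vanishing defines `discHyperplane a S`, as a linear form in the
right-hand sides `y`. -/
noncomputable def discForm (a : Matrix (Fin n) (Fin m) ℝ) (S : Circuit n m) :
    (Fin n → ℝ) →ₗ[ℝ] ℝ where
  toFun y := (augmented a S y).det
  map_add' y z := by
    rw [augmented_eq a S (y + z), augmented_eq a S y, augmented_eq a S z]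
    exact Matrix.det_updateCol_add (augmented a S 0) (Fin.last m)
      (fun k => y (S.1.orderEmbOfFin S.2 k)) (fun k => z (S.1.orderEmbOfFin S.2 k))
  map_smul' c y := by
    rw [augmented_eq a S (c • y), augmented_eq a S y]
    exact Matrix.det_updateCol_smul (augmented a S 0) (Fin.last m) c
      (fun k => y (S.1.orderEmbOfFin S.2 k))

theorem discForm_apply (a : Matrix (Fin n) (Fin m) ℝ) (S : Circuit n m) (y : Fin n → ℝ) :
    discForm a S y = (augmented a S y).det := rfl

theorem ker_discForm (a : Matrix (Fin n) (Fin m) ℝ) (S : Circuit n m) :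
    LinearMap.ker (discForm a S) = discHyperplane a S := rfl

theorem discForm_congr {S : Circuit n m} {y z : Fin n → ℝ} (h : ∀ i ∈ S.1, y i = z i) :
    discForm a S y = discForm a S z := by
  have : ∀ k, y (S.1.orderEmbOfFin S.2 k) = z (S.1.orderEmbOfFin S.2 k) := fun k =>
    h _ (Finset.orderEmbOfFin_mem _ _ _)
  simp only [discForm_apply, augmented, this]

theorem discForm_eq_zero_iff {S : Circuit n m} {y : Fin n → ℝ} :
    discForm a S y = 0 ↔
      ∃ (x : Fin m → ℝ) (c : ℝ), (x ≠ 0 ∨ c ≠ 0) ∧ ∀ i ∈ S.1, a i ⬝ᵥ x + y i * c = 0 := by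
  have hmul : ∀ (x : Fin m → ℝ) (c : ℝ) k,
      (augmented a S y *ᵥ (Fin.snoc x c : Fin (m + 1) → ℝ)) k =
        a (S.1.orderEmbOfFin S.2 k) ⬝ᵥ x + y (S.1.orderEmbOfFin S.2 k) * c := by
    intro x c k
    simp [Matrix.mulVec, dotProduct, augmented, Fin.sum_univ_castSucc]
  rw [discForm_apply, ← Matrix.exists_mulVec_eq_zero_iff]
  constructor
  · rintro ⟨v, hv, h⟩
    rw [← Fin.snoc_init_self v] at h hv
    refine ⟨Fin.init v, v (Fin.last m), ?_, fun i hi => ?_⟩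
    · by_contra! h0
      refine hv ?_
      rw [h0.1, h0.2]
      funext k
      refine Fin.lastCases ?_ (fun k => ?_) k <;> simp
    · obtain ⟨k, rfl⟩ : i ∈ Set.range (S.1.orderEmbOfFin S.2) := by
        rw [Finset.range_orderEmbOfFin]; exact hi
      rw [← hmul, h, Pi.zero_apply]
  · rintro ⟨x, c, h0, h⟩
    refine ⟨Fin.snoc x c, fun hz => ?_, funext fun k => ?_⟩
    · rcases h0 with h0 | h0
      · exact h0 (funext fun k => by simpa using congrFun hz k.castSucc)
      · exact h0 (by simpa using congrFun hz (Fin.last m))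
    · rw [hmul, h _ (Finset.orderEmbOfFin_mem _ _ _), Pi.zero_apply]

theorem discForm_row (S : Circuit n m) (x : Fin m → ℝ) :
    discForm a S (fun i => a i ⬝ᵥ x) = 0 :=
  discForm_eq_zero_iff.mpr ⟨x, -1, Or.inr (by norm_num), fun i _ => by ring⟩

/-- The coefficient of `discForm a S` at `k ∈ S` is, up to sign, a maximal minor of `a`. -/
theorem IsNormalMatrix.discForm_single_ne_zero (ha : IsNormalMatrix a) {S : Circuit n m}
    {k : Fin n} (hk : k ∈ S.1) : discForm a S (Pi.single k 1) ≠ 0 := by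
  rw [Ne, discForm_eq_zero_iff]
  rintro ⟨x, c, h0, h⟩
  have hx : x = 0 := by
    refine ha.eq_zero (s := S.1.erase k) (by rw [Finset.card_erase_of_mem hk, S.2]; rfl) ?_
    intro i hi
    simpa [Finset.ne_of_mem_erase hi] using h i (Finset.mem_of_mem_erase hi)
  have hc := h k hk
  simp [hx] at hc h0
  exact h0 hc

/-- If `x` solves all the equations of `S` except possibly the one with subscript `k`, then
`discForm a S b` is a fixed nonzero multiple of the defect in the equation `k`. -/
theorem discForm_eq_mul {S : Circuit n m} {k : Fin n} {b : Fin n → ℝ} {x : Fin m → ℝ}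
    (h : ∀ i ∈ S.1, i ≠ k → a i ⬝ᵥ x = b i) :
    discForm a S b = (b k - a k ⬝ᵥ x) * discForm a S (Pi.single k 1) := by
  have h1 : discForm a S (b - fun i => a i ⬝ᵥ x) =
      discForm a S ((b k - a k ⬝ᵥ x) • Pi.single k 1) := by
    refine discForm_congr fun i hi => ?_
    by_cases hik : i = k
    · subst hik; simp
    · simp [hik, h i hi hik]
  rwa [map_sub, discForm_row, sub_zero, map_smul, smul_eq_mul] at h1

/-! ### Flats of the arrangement with given right-hand sides -/

/-- The arrangement of the hyperplanes `{x | a i · x = b i}`. -/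
def arr (a : Matrix (Fin n) (Fin m) ℝ) (b : Fin n → ℝ) : Fin n → AffineSubspace ℝ (Fin m → ℝ) :=
  fun i => hyperplane (a i) (b i)

theorem mem_flat_arr {b : Fin n → ℝ} {s : Finset (Fin n)} {x : Fin m → ℝ} :
    x ∈ flat (arr a b) s ↔ ∀ i ∈ s, a i ⬝ᵥ x = b i := by
  simp only [flat, AffineSubspace.mem_iInf_iff]
  rfl

theorem IsNormalMatrix.direction_flat_arr (ha : IsNormalMatrix a) (b : Fin n → ℝ)
    {s : Finset (Fin n)} (hs : s.card ≤ m) :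
    (flat (arr a b) s).direction = LinearMap.ker (rowMap a s) := by
  obtain ⟨x, hx⟩ := ha.exists_solution hs b
  ext u
  rw [← AffineSubspace.vadd_mem_iff_mem_direction u (mem_flat_arr.mpr hx), mem_flat_arr,
    mem_ker_rowMap]
  refine forall₂_congr fun i hi => ?_
  rw [vadd_eq_add, dotProduct_add, hx i hi, add_eq_right]

theorem IsNormalMatrix.isGeneric_arr_iff (ha : IsNormalMatrix a) {b : Fin n → ℝ} :
    IsGeneric (arr a b) ↔ ∀ S, discForm a S b ≠ 0 := by
  constructor
  · intro h S h0
    obtain ⟨k, hk⟩ : S.1.Nonempty := Finset.card_pos.mp (by rw [S.2]; omega)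
    obtain ⟨x, hx⟩ := ha.exists_solution (s := S.1.erase k)
      (by rw [Finset.card_erase_of_mem hk, S.2]; rfl) b
    have hx' : ∀ i ∈ S.1, i ≠ k → a i ⬝ᵥ x = b i := fun i hi hik =>
      hx i (Finset.mem_erase.mpr ⟨hik, hi⟩)
    rw [discForm_eq_mul hx', mul_eq_zero, or_iff_left (ha.discForm_single_ne_zero hk)] at h0
    have hmem : x ∈ flat (arr a b) S.1 := mem_flat_arr.mpr fun i hi => by
      by_cases hik : i = k
      · rw [hik]; linarith
      · exact hx' i hi hik
    rw [h.eq_bot_of_lt S.1 (by rw [S.2]; omega)] at hmem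
    exact AffineSubspace.notMem_bot ℝ _ x hmem
  · intro h
    refine ⟨fun s _ hs => ?_, fun s _ hs => ?_, fun s hs => ?_⟩
    · obtain ⟨x, hx⟩ := ha.exists_solution hs b
      exact ⟨x, mem_flat_arr.mpr hx⟩
    · rw [ha.direction_flat_arr b hs, ha.finrank_ker_rowMap hs]
    · obtain ⟨S, hSs, hS⟩ := Finset.exists_subset_card_eq (Nat.succ_le_of_lt hs)
      rw [← AffineSubspace.coe_eq_bot_iff]
      refine Set.eq_empty_of_forall_notMem fun x hx => ?_
      refine h ⟨S, hS⟩ ?_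
      rw [← discForm_row (a := a) ⟨S, hS⟩ x]
      exact discForm_congr fun i hi => (mem_flat_arr.mp hx i (hSs hi)).symm

/-! ### The order of two vertices on a line -/

/-- The order of the vertices with subscripts `j` and `k` on the line `flat (arr a b) s` is given
by the sign of the linear form of the circuit `s ∪ {j, k}`, up to a factor independent of `b`. -/
theorem IsNormalMatrix.precedes_iff (ha : IsNormalMatrix a) {b : Fin n → ℝ} {s : Finset (Fin n)}
    (hs : s.card + 1 = m) {j k : Fin n} (hk : k ∉ s) {S : Circuit n m}
    (hS : S.1 = insert j (insert k s)) {u : Fin m → ℝ} (hu : u ≠ 0)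
    (hus : ∀ i ∈ s, a i ⬝ᵥ u = 0) {p q : Fin m → ℝ} (hp : p ∈ flat (arr a b) (insert j s))
    (hq : q ∈ flat (arr a b) (insert k s)) :
    Precedes u p q ↔ 0 < discForm a S b * (a k ⬝ᵥ u * discForm a S (Pi.single k 1)) := by
  have hku := ha.dotProduct_ne_zero hs hk hu hus
  have hkS : k ∈ S.1 := by simp [hS]
  have hne := ha.discForm_single_ne_zero hkS
  rw [mem_flat_arr] at hp hq
  have hD : discForm a S b = (b k - a k ⬝ᵥ p) * discForm a S (Pi.single k 1) := by
    refine discForm_eq_mul fun i hi hik => hp i ?_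
    rw [hS, Finset.mem_insert, Finset.mem_insert] at hi
    rw [Finset.mem_insert]
    tauto
  set t : ℝ := (b k - a k ⬝ᵥ p) / (a k ⬝ᵥ u) with ht
  have htk : t * (a k ⬝ᵥ u) = b k - a k ⬝ᵥ p := div_mul_cancel₀ _ hku
  have hq' : q = p + t • u := by
    refine ha.eq_of_eq (s := insert k s) (by rw [Finset.card_insert_of_notMem hk, hs]) ?_
    intro i hi
    rw [hq i hi, dotProduct_add, dotProduct_smul, smul_eq_mul]
    rcases Finset.mem_insert.mp hi with rfl | hi
    · rw [htk]; ring
    · rw [hus i hi, hp i (Finset.mem_insert_of_mem hi)]; ring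
  have hprod : discForm a S b * (a k ⬝ᵥ u * discForm a S (Pi.single k 1)) =
      t * (a k ⬝ᵥ u * discForm a S (Pi.single k 1)) ^ 2 := by
    rw [hD, ← htk]; ring
  have hsq : 0 < (a k ⬝ᵥ u * discForm a S (Pi.single k 1)) ^ 2 :=
    sq_pos_of_ne_zero (mul_ne_zero hku hne)
  rw [hprod, mul_pos_iff_of_pos_right hsq]
  constructor
  · rintro ⟨t', ht', h⟩
    have : t' • u = t • u := add_left_cancel (h.symm.trans hq')
    rwa [← smul_left_injective ℝ hu this]
  · exact fun h => ⟨t, h, hq'⟩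

theorem not_precedes_self {u p : Fin m → ℝ} (hu : u ≠ 0) : ¬ Precedes u p p := by
  rintro ⟨t, ht, h⟩
  rw [left_eq_add, smul_eq_zero] at h
  exact h.elim ht.ne' hu

/-- A property of the circuits that agrees on any two circuits sharing `m - 1` subscripts is
constant: circuits can be exchanged one subscript at a time. -/
theorem circuit_connected (hm : 0 < m) {Q : Circuit n m → Prop}
    (hQ : ∀ s : Finset (Fin n), s.card + 1 = m → ∀ S T : Circuit n m, s ⊆ S.1 → s ⊆ T.1 →
      (Q S ↔ Q T)) (S T : Circuit n m) : Q S ↔ Q T := by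
  induction h : (T.1 \ S.1).card using Nat.strong_induction_on generalizing S with
  | _ d ih =>
    by_cases hsub : T.1 ⊆ S.1
    · have : T = S := Subtype.ext (Finset.eq_of_subset_of_card_le hsub (by rw [S.2, T.2]))
      rw [this]
    · obtain ⟨x, hxT, hxS⟩ := Finset.not_subset.mp hsub
      have hsub' : ¬ S.1 ⊆ T.1 := fun h' => hsub
        (Finset.eq_of_subset_of_card_le h' (by rw [S.2, T.2])).symm.subset
      obtain ⟨y, hyS, hyT⟩ := Finset.not_subset.mp hsub'
      have hxe : x ∉ S.1.erase y := fun h' => hxS (Finset.mem_of_mem_erase h')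
      have hce : (S.1.erase y).card = m := by rw [Finset.card_erase_of_mem hyS, S.2]; rfl
      let S' : Circuit n m := ⟨insert x (S.1.erase y), by
        rw [Finset.card_insert_of_notMem hxe, hce]⟩
      obtain ⟨s, hs, hsc⟩ := Finset.exists_subset_card_eq
        (s := S.1.erase y) (n := m - 1) (by omega)
      have hlt : (T.1 \ S'.1).card < d := by
        rw [← h]
        refine Finset.card_lt_card (Finset.ssubset_iff_of_subset ?_ |>.mpr ⟨x, ?_, ?_⟩)
        · intro z hz
          simp only [S', Finset.mem_sdiff, Finset.mem_insert, Finset.mem_erase, not_or] at hz ⊢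
          refine ⟨hz.1, fun hzS => hz.2.2 ⟨?_, hzS⟩⟩
          rintro rfl
          exact hyT hz.1
        · exact Finset.mem_sdiff.mpr ⟨hxT, hxS⟩
        · simp [S']
      rw [hQ s (by omega) S S' (hs.trans (Finset.erase_subset _ _))
        (hs.trans (Finset.subset_insert _ _))]
      exact ih _ hlt S' rfl

theorem mul_pos_congr {x y c : ℝ} (hx : x ≠ 0) (hy : y ≠ 0) (h : 0 < x ↔ 0 < y) :
    0 < x * c ↔ 0 < y * c := by
  rcases lt_or_gt_of_ne hx with hx | hx
  · have hy' := lt_of_le_of_ne (not_lt.mp (h.not.mp hx.not_gt)) hy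
    rw [← neg_mul_neg x, ← neg_mul_neg y, mul_pos_iff_of_pos_left (neg_pos.mpr hx),
      mul_pos_iff_of_pos_left (neg_pos.mpr hy')]
  · rw [mul_pos_iff_of_pos_left hx, mul_pos_iff_of_pos_left (h.mp hx)]

/-- Two generic arrangements with the same coefficients are isomorphic exactly when the
determinants of their circuits have everywhere the same sign or everywhere opposite signs. -/
theorem IsNormalMatrix.subscriptIso_arr_iff (ha : IsNormalMatrix a) (hm : 0 < m)
    {b b' : Fin n → ℝ} (hb : ∀ S, discForm a S b ≠ 0) (hb' : ∀ S, discForm a S b' ≠ 0) :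
    SubscriptIso (arr a b) (arr a b') ↔
      (∀ S, 0 < discForm a S b ↔ 0 < discForm a S b') ∨
      (∀ S, 0 < discForm a S b ↔ 0 < discForm a S (-b')) := by
  have hmem : ∀ {b s u}, s.card + 1 = m →
      (u ∈ (flat (arr a b) s).direction ↔ ∀ i ∈ s, a i ⬝ᵥ u = 0) := fun {b s u} hs => by
    rw [ha.direction_flat_arr b (by omega), mem_ker_rowMap]
  rw [subscriptIso_iff]
  constructor
  · intro h
    have hconst := circuit_connected hm
      (Q := fun S => 0 < discForm a S b ↔ 0 < discForm a S b') ?_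
    · by_cases hex : ∃ S, 0 < discForm a S b ↔ 0 < discForm a S b'
      · obtain ⟨T, hT⟩ := hex
        exact Or.inl fun S => (hconst S T).mpr hT
      · refine Or.inr fun S => ?_
        have hS : ¬ (0 < discForm a S b ↔ 0 < discForm a S b') := fun h' => hex ⟨S, h'⟩
        have hneg : 0 < discForm a S b' ↔ ¬ discForm a S b' < 0 := by
          rw [not_lt, (hb' S).symm.le_iff_lt]
        rw [map_neg, neg_pos]
        tauto
    · intro s hs S T hsS hsT
      obtain ⟨u, hu, hu0, u', hu', hu0', hh⟩ := h s hs
      have h1 : finrank ℝ (LinearMap.ker (rowMap a s)) = 1 := by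
        rw [ha.finrank_ker_rowMap (by omega)]; omega
      rw [ha.direction_flat_arr _ (by omega)] at hu hu'
      obtain ⟨c, hc⟩ := (finrank_eq_one_iff_of_nonzero' (⟨u, hu⟩ : LinearMap.ker (rowMap a s))
        (fun e => hu0 (congrArg Subtype.val e))).mp h1 ⟨u', hu'⟩
      have hcu : u' = c • u := (congrArg Subtype.val hc).symm
      have hc0 : c ≠ 0 := by
        rintro rfl
        exact hu0' (by simpa using hcu)
      rw [mem_ker_rowMap] at hu hu'
      -- the relation between the signs is the sign of `c`, for every circuit containing `s`
      have key : ∀ U : Circuit n m, s ⊆ U.1 →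
          ((0 < discForm a U b ↔ 0 < discForm a U b') ↔ 0 < c) := by
        intro U hU
        obtain ⟨j, k, hjk, hd⟩ := Finset.card_eq_two.mp
          (show (U.1 \ s).card = 2 by rw [Finset.card_sdiff_of_subset hU, U.2]; omega)
        have hj : j ∉ s := (Finset.mem_sdiff.mp (show j ∈ U.1 \ s by simp [hd])).2
        have hk : k ∉ s := (Finset.mem_sdiff.mp (show k ∈ U.1 \ s by simp [hd])).2
        have hUe : U.1 = insert j (insert k s) := by
          rw [← Finset.sdiff_union_of_subset hU, hd]
          ext; simp
        have hcj : (insert j s).card ≤ m := by rw [Finset.card_insert_of_notMem hj, hs]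
        have hck : (insert k s).card ≤ m := by rw [Finset.card_insert_of_notMem hk, hs]
        obtain ⟨p, hp⟩ := ha.exists_solution hcj b
        obtain ⟨q, hq⟩ := ha.exists_solution hck b
        obtain ⟨p', hp'⟩ := ha.exists_solution hcj b'
        obtain ⟨q', hq'⟩ := ha.exists_solution hck b'
        rw [← mem_flat_arr] at hp hq hp' hq'
        have e := hh j hj k hk p hp q hq p' hp' q' hq'
        rw [ha.precedes_iff hs hk hUe hu0 hu hp hq, ha.precedes_iff hs hk hUe hu0' hu' hp' hq',
          hcu, dotProduct_smul, smul_eq_mul] at e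
        have hκ : a k ⬝ᵥ u * discForm a U (Pi.single k 1) ≠ 0 :=
          mul_ne_zero (ha.dotProduct_ne_zero hs hk hu0 hu)
            (ha.discForm_single_ne_zero (by simp [hUe]))
        have hb1 := hb U
        have hb2 := hb' U
        rw [mul_assoc c] at e
        generalize a k ⬝ᵥ u * discForm a U (Pi.single k 1) = κ at *
        generalize discForm a U b = x at *
        generalize discForm a U b' = y at *
        simp only [mul_pos_iff, mul_neg_iff] at e
        rcases lt_or_gt_of_ne hκ with h1 | h1 <;> rcases lt_or_gt_of_ne hb1 with h2 | h2 <;>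
          rcases lt_or_gt_of_ne hb2 with h3 | h3 <;> rcases lt_or_gt_of_ne hc0 with h4 | h4 <;>
          simp only [h1, h2, h3, h4, h1.not_gt, h2.not_gt, h3.not_gt, h4.not_gt] at e ⊢ <;>
          simp at e ⊢
      rw [key S hsS, key T hsT]
  · intro h s hs
    obtain ⟨u, hu, -⟩ := finrank_eq_one_iff'.mp
      (show finrank ℝ (LinearMap.ker (rowMap a s)) = 1 by
        rw [ha.finrank_ker_rowMap (by omega)]; omega)
    have hus : ∀ i ∈ s, a i ⬝ᵥ (u : Fin m → ℝ) = 0 := mem_ker_rowMap.mp u.2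
    have hu0 : (u : Fin m → ℝ) ≠ 0 := fun h => hu (Subtype.ext h)
    -- the line keeps its orientation in the first case and reverses it in the second
    obtain ⟨c, hc0, hc⟩ : ∃ c : ℝ, c ≠ 0 ∧
        ∀ S, (0 < discForm a S b ↔ 0 < discForm a S b' * c) := by
      rcases h with h | h
      · exact ⟨1, one_ne_zero, by simpa using h⟩
      · exact ⟨-1, by norm_num, by simpa using h⟩
    have hcu : ∀ i ∈ s, a i ⬝ᵥ (c • (u : Fin m → ℝ)) = 0 := fun i hi => by
      rw [dotProduct_smul, hus i hi, smul_zero]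
    have hcu0 : c • (u : Fin m → ℝ) ≠ 0 := smul_ne_zero hc0 hu0
    refine ⟨u, (hmem hs).mpr hus, hu0, c • (u : Fin m → ℝ), (hmem hs).mpr hcu, hcu0, ?_⟩
    intro j hj k hk p hp q hq p' hp' q' hq'
    by_cases hjk : j = k
    · subst hjk
      rw [vertex_unique (ha.isGeneric_arr_iff.mpr hb) s hs j hj hp hq,
        vertex_unique (ha.isGeneric_arr_iff.mpr hb') s hs j hj hp' hq']
      exact iff_of_false (not_precedes_self hu0) (not_precedes_self hcu0)
    · let S : Circuit n m := ⟨insert j (insert k s), by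
        rw [Finset.card_insert_of_notMem (by simp [hjk, hj]), Finset.card_insert_of_notMem hk, hs]⟩
      rw [ha.precedes_iff (S := S) hs hk rfl hu0 hus hp hq,
        ha.precedes_iff (S := S) hs hk rfl hcu0 hcu hp' hq', dotProduct_smul, smul_eq_mul,
        mul_assoc c, ← mul_assoc _ c]
      exact mul_pos_congr (hb S) (mul_ne_zero (hb' S) hc0) (hc S)

end Geometry

/-! ### Isomorphism classes and regions -/

section Classes

variable {n m : ℕ} {a : Matrix (Fin n) (Fin m) ℝ}

/-- Every isomorphism class contains exactly one pair of opposite cells, hence exactly one cell on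
the positive side of a fixed hyperplane of the discriminantal arrangement. -/
theorem IsNormalMatrix.exists_bijective_isoClasses (ha : IsNormalMatrix a) (hm : 0 < m)
    (S₀ : Circuit n m) :
    ∃ g : ((patterns (discForm a) ⊤ Finset.univ).filter fun P => S₀ ∈ P) → IsoClasses a,
      Function.Bijective g := by
  classical
  have hex : ∀ P : ((patterns (discForm a) ⊤ Finset.univ).filter fun P => S₀ ∈ P),
      ∃ y, InCell (discForm a) Finset.univ P.1 y := fun P => by
    obtain ⟨-, y, -, hy⟩ := mem_patterns.mp (Finset.mem_filter.mp P.2).1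
    exact ⟨y, hy⟩
  choose y hy using hex
  have hS₀ : ∀ P : ((patterns (discForm a) ⊤ Finset.univ).filter fun P => S₀ ∈ P), S₀ ∈ P.1 :=
    fun P => (Finset.mem_filter.mp P.2).2
  let H : ∀ b : Fin n → ℝ, (∀ S, discForm a S b ≠ 0) → GenericArrangement a := fun b hb =>
    ⟨arr a b, ⟨b, fun _ => rfl⟩, ha.isGeneric_arr_iff.mpr hb⟩
  refine ⟨fun P => Quotient.mk (subscriptSetoid a) (H (y P) (hy P).ne_zero), ?_, ?_⟩
  · intro P Q h
    have hiso : SubscriptIso (arr a (y P)) (arr a (y Q)) := Quotient.exact h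
    rw [ha.subscriptIso_arr_iff hm (hy P).ne_zero (hy Q).ne_zero] at hiso
    rcases hiso with h | h
    · refine Subtype.ext (Finset.ext fun S => ?_)
      rw [← (hy P).pos_iff, ← (hy Q).pos_iff, h]
    · have h0 := h S₀
      rw [(hy P).pos_iff, (hy Q).neg.pos_iff, Finset.mem_compl] at h0
      exact absurd (hS₀ Q) (h0.mp (hS₀ P))
  · rintro ⟨A, ⟨b, hb⟩, hA⟩
    have hAb : A = arr a b := funext hb
    subst hAb
    have hne := ha.isGeneric_arr_iff.mp hA
    -- replacing `b` by `-b` if necessary, its cell is on the positive side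
    have hc : ∃ b' : Fin n → ℝ, (b' = b ∨ b' = -b) ∧ 0 < discForm a S₀ b' := by
      rcases lt_or_gt_of_ne (hne S₀) with h | h
      · exact ⟨-b, Or.inr rfl, by simpa using h⟩
      · exact ⟨b, Or.inl rfl, h⟩
    obtain ⟨b', hb', hpos⟩ := hc
    have hne' : ∀ S, discForm a S b' ≠ 0 := by
      rcases hb' with rfl | rfl
      · exact hne
      · exact fun S => by simpa using hne S
    have hcell := inCell_filter_pos hne'
    let P : ((patterns (discForm a) ⊤ Finset.univ).filter fun P => S₀ ∈ P) :=
      ⟨Finset.univ.filter fun S => 0 < discForm a S b', Finset.mem_filter.mpr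
        ⟨mem_patterns.mpr ⟨Finset.subset_univ _, b', Submodule.mem_top, hcell⟩,
          by simpa using hpos⟩⟩
    have hsign : ∀ S, 0 < discForm a S (y P) ↔ 0 < discForm a S b' := fun S => by
      rw [(hy P).pos_iff, hcell.pos_iff]
    refine ⟨P, Quotient.sound ?_⟩
    change SubscriptIso (arr a (y P)) (arr a b)
    rw [ha.subscriptIso_arr_iff hm (hy P).ne_zero hne]
    rcases hb' with rfl | rfl
    · exact Or.inl hsign
    · exact Or.inr hsign

theorem range_ker_discForm (a : Matrix (Fin n) (Fin m) ℝ) :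
    (Set.range fun S => LinearMap.ker (discForm a S)) = discArrangement a := rfl

theorem IsNormalMatrix.card_isoClasses (ha : IsNormalMatrix a) (hm : 0 < m) (hmn : m < n) :
    Finite (IsoClasses a) ∧ numRegions (discArrangement a) = 2 * Nat.card (IsoClasses a) := by
  classical
  obtain ⟨S, -, hS⟩ := Finset.exists_subset_card_eq (s := (Finset.univ : Finset (Fin n)))
    (n := m + 1) (by simpa using hmn)
  obtain ⟨g, hg⟩ := ha.exists_bijective_isoClasses hm ⟨S, hS⟩
  refine ⟨Finite.of_surjective g hg.2, ?_⟩
  rw [← range_ker_discForm, numRegions_eq_card_patterns, card_patterns_eq_two_mul _ ⟨S, hS⟩,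
    ← Nat.card_eq_of_bijective g hg, Nat.card_eq_fintype_card, Fintype.card_coe]

theorem IsNormalMatrix.discHyperplane_ne_top (ha : IsNormalMatrix a) (S : Circuit n m) :
    discHyperplane a S ≠ ⊤ := by
  intro h
  obtain ⟨k, hk⟩ : S.1.Nonempty := Finset.card_pos.mp (by rw [S.2]; omega)
  refine ha.discForm_single_ne_zero hk ?_
  rw [← LinearMap.mem_ker, ker_discForm, h]
  exact Submodule.mem_top

end Classes

end Discriminantal

open Discriminantal in
theorem mainTheorem3 (n m : ℕ) (hm : 1 < m) (hmn : m < n)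
    (L : Fin n → Submodule ℝ (Fin m → ℝ)) (hL : Discriminantal.IsNormalSystem L)
    (a : Matrix (Fin n) (Fin m) ℝ) (ha : Discriminantal.IsCoeffMatrix a L)
    (hfree : Discriminantal.IsConcurrencyFree a) :
    Finite (Discriminantal.IsoClasses a) ∧
    (Nat.card (Discriminantal.IsoClasses a) : ℚ) =
      1 / 2 * (Discriminantal.numRegions (Discriminantal.discArrangement a) : ℚ) ∧
    1 / 2 * (Discriminantal.numRegions (Discriminantal.discArrangement a) : ℚ) =
      (-1) ^ n / 2 *
        (((Discriminantal.charPoly (Discriminantal.discArrangement a)).eval (-1) : ℤ) : ℚ) ∧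
    (-1) ^ n / 2 *
        (((Discriminantal.charPoly (Discriminantal.discArrangement a)).eval (-1) : ℤ) : ℚ) =
      1 / 2 * ∑ D : Finset (Discriminantal.Circuit n m),
        (-1 : ℚ) ^ (n + D.card + Discriminantal.interDim a D) ∧
    1 / 2 * ∑ D : Finset (Discriminantal.Circuit n m),
        (-1 : ℚ) ^ (n + D.card + Discriminantal.interDim a D) =
      1 / 2 * ∑ D : Finset (Discriminantal.Circuit n m),
        (-1 : ℚ) ^ (D.card + Discriminantal.concRank (Discriminantal.concClosure D)) ∧
    (∀ D : Finset (Discriminantal.Circuit n m),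
      (n : ℤ) - Discriminantal.interDim a D =
        Discriminantal.concRank (Discriminantal.concClosure D) ∧
      ∀ B : Finset (Discriminantal.Circuit n m),
        Discriminantal.IsBaseCollection B (Discriminantal.concClosure D) →
        B.card = Discriminantal.concRank (Discriminantal.concClosure D)) := by
  have hA : IsNormalMatrix a := hL.isNormalMatrix ha
  obtain ⟨hfin, hcard⟩ := hA.card_isoClasses (by omega) hmn
  have hregions : (numRegions (discArrangement a) : ℚ) =
      ∑ D : Finset (Circuit n m), (-1 : ℚ) ^ (n + D.card + interDim a D) := by
    exact_mod_cast numRegions_eq_sum (discForm a)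
  have hchar : (((charPoly (discArrangement a)).eval (-1) : ℤ) : ℚ) =
      ∑ D : Finset (Circuit n m), (-1 : ℚ) ^ D.card * (-1) ^ interDim a D := by
    exact_mod_cast eval_charPoly (discHyperplane a) hA.discHyperplane_ne_top (-1)
  have hwhitney : (-1) ^ n / 2 * (((charPoly (discArrangement a)).eval (-1) : ℤ) : ℚ) =
      1 / 2 * ∑ D : Finset (Circuit n m), (-1 : ℚ) ^ (n + D.card + interDim a D) := by
    rw [hchar, Finset.mul_sum, Finset.mul_sum]
    exact Finset.sum_congr rfl fun D _ => by ring
  refine ⟨hfin, ?_, ?_, hwhitney, ?_, fun D => ⟨(hfree.concRank_eq D).symm, fun B hB => ?_⟩⟩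
  · rw [hcard]
    push_cast
    ring
  · rw [hwhitney, hregions]
  · congr 1
    refine Finset.sum_congr rfl fun D _ => ?_
    -- the exponents differ by `2 * interDim a D`
    have h : n + D.card + interDim a D =
        D.card + concRank (concClosure D) + 2 * interDim a D := by
      have := hfree.concRank_eq D
      omega
    rw [h, pow_add, pow_mul, neg_one_sq, one_pow, mul_one]
  · have h1 := hfree.card_eq hB
    have h2 := hfree.concRank_eq D
    omega
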